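/- Let $d\ge 2$ be an integer and let $\alpha>1/d$ be a real number. Let $\mathrm{Diff}_+^{1+\alpha}([0,1])$ be the group of orientation-preserving $C^1$ diffeomorphisms $f$ of $[0,1]$ (with one-sided derivatives at the endpoints, and $f'>0$ on $[0,1]$) whose derivative is $\alpha$-Hölder continuous, that is, for which there is $C>0$ with $|f'(x)-f'(y)|\le C|x-y|^{\alpha}$ for all $x,y\in[0,1]$. Let $G$ be a subgroup of $\mathrm{Diff}_+^{1+\alpha}([0,1])$ whose action on $(0,1)$ is semiconjugate to a free action of $\mathbb Z^d$ by translations of the real line; that is, there exist a surjective group homomorphism $\rho:G\to\mathbb Z^d$, an injective group homomorphism $\tau:\mathbb Z^d\to\mathbb R$, and a continuous, non-decreasing, surjective map $\varphi:(0,1)\to\mathbb R$ such that $$\varphi(g(x))=\varphi(x)+\tau(\rho(g))\qquad\text{for all } g\in G,\ x\in(0,1).$$ Then $G$ acts minimally on $(0,1)$, that is, the $G$-orbit of every point of $(0,1)$ is dense in $(0,1)$; and $G$ is Abelian. -/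

import Mathlib

/-- `f` belongs to `Diff_+^{1+α}([0,1])`: the homeomorphism `f` of `[0,1]` is increasing, has at
each point of `[0,1]` a positive derivative (one-sided at the endpoints), and its derivative is
`α`-Hölder continuous. As `f' > 0`, the inverse of `f` is differentiable as well. -/
def IsDiffHolder (α : ℝ) (f : unitInterval ≃ₜ unitInterval) : Prop :=
  StrictMono f ∧
  ∃ f' : unitInterval → ℝ,
    (∀ x : unitInterval, 0 < f' x ∧
      HasDerivWithinAt
        (Set.IccExtend (zero_le_one : (0 : ℝ) ≤ 1) (fun t : unitInterval => (f t : ℝ)))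
        (f' x) (Set.Icc (0 : ℝ) 1) (x : ℝ)) ∧
    ∃ C : ℝ, 0 < C ∧ ∀ x y : unitInterval, |f' x - f' y| ≤ C * |(x : ℝ) - (y : ℝ)| ^ α

/-- The action `v · s = s + τ v` of `ℤ^d` on the real line by translations is free. -/
def IsFreeTranslationAction {d : ℕ} (τ : (Fin d → ℤ) →+ ℝ) : Prop :=
  ∀ (v : Fin d → ℤ) (s : ℝ), s + τ v = s → v = 0

/-- The action of `G` on `(0,1)` is semiconjugate to a free action of `ℤ^d` by translations of the
line: there are a surjective homomorphism `ρ : G → ℤ^d`, a free action of `ℤ^d` on the line by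
translations, and a continuous, non-decreasing map `φ` from `(0,1)` onto the line that intertwines
the action of each `g ∈ G` on `(0,1)` with that of `ρ g` on the line. Only the values of `φ` on
`(0,1)` matter. -/
def IsSemiconjToFreeTranslations (d : ℕ) (G : Subgroup (unitInterval ≃ₜ unitInterval)) : Prop :=
  ∃ (ρ : G →* Multiplicative (Fin d → ℤ)) (τ : (Fin d → ℤ) →+ ℝ) (φ : unitInterval → ℝ),
    Function.Surjective ρ ∧
    IsFreeTranslationAction τ ∧
    ContinuousOn φ (Set.Ioo 0 1) ∧
    MonotoneOn φ (Set.Ioo 0 1) ∧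
    Set.SurjOn φ (Set.Ioo 0 1) Set.univ ∧
    ∀ (g : G), ∀ x ∈ Set.Ioo (0 : unitInterval) 1,
      φ ((g : unitInterval ≃ₜ unitInterval) x) = φ x + τ (Multiplicative.toAdd (ρ g))

/-- `G` acts minimally on `(0,1)`: the orbit of each point of `(0,1)` is dense in `(0,1)`. -/
def ActsMinimally (G : Subgroup (unitInterval ≃ₜ unitInterval)) : Prop :=
  ∀ x ∈ Set.Ioo (0 : unitInterval) 1,
    Set.Ioo (0 : unitInterval) 1 ⊆ closure {y : unitInterval | ∃ g ∈ G, g x = y}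

/-! Once `φ` is injective on `(0,1)`, both conclusions follow: commutators act trivially because
translations commute, and orbits are dense because `τ` has dense range. So the point is that no
fibre of `φ` is a nondegenerate interval, which is `length_eq_zero`.

Suppose the fibre over `s` is nondegenerate, and let `ℓ v` be the length of the fibre over `s + τ
v`. These fibres are disjoint, so `∑ ℓ v ≤ 1` over `ℕ^d`. Composing lifts of the generators along a
monotone lattice path from `0` gives an element of `G` whose distortion near the fibre is controlled
by the sum of `ℓ v ^ α` along the path, the cost. Level `k` of `ℕ^d` has about `k^(d-1)` points, so
by Young's inequality the averages of `ℓ ^ α` over the levels have a bounded sum exactly in the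
range `α > 1/d` (`exists_sum_average_rpow_le`). Hence most points of each level are reached by paths
of bounded cost, and two such points can be found that differ by a prescribed vector `u`
(`exists_pair_cost_le`).

Take `τ u > 0` so small that the fibres over `s ± τ u` lie in a thin neighbourhood of the fibre over
`s`, hence are much shorter than it. Bounded distortion preserves this comparison (`length_add_le`).
Applied to the two elements, it makes each of two fibres of positive length at most a quarter of the
other. -/

/-! ### Levels of `ℕ^d` and their cardinalities -/

/-- The points of `ℕ^d` whose coordinates add up to `n`. -/
def level (d n : ℕ) : Finset (Fin d → ℕ) := Finset.piAntidiag Finset.univ n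

lemma mem_level {d n : ℕ} {v : Fin d → ℕ} : v ∈ level d n ↔ ∑ i, v i = n := by
  simp [level]

lemma add_mem_level {d m n : ℕ} {v w : Fin d → ℕ} (hv : v ∈ level d m) (hw : w ∈ level d n) :
    v + w ∈ level d (m + n) := by
  rw [mem_level] at *
  simp [Finset.sum_add_distrib, hv, hw]

lemma single_mem_level {d : ℕ} (i : Fin d) : Pi.single i 1 ∈ level d 1 := by
  simp [mem_level]

lemma level_zero (d : ℕ) : level d 0 = {0} := by
  simp [level]

/-- Double counting of the edges of `ℕ^d` between two consecutive levels. -/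
lemma sum_level_succ {d : ℕ} (n : ℕ) (F : (Fin d → ℕ) → ℝ) :
    ∑ w ∈ level d (n + 1), ∑ i, (w i : ℝ) * F (w - Pi.single i 1) =
      (n + d) * ∑ v ∈ level d n, F v := by
  -- Adding `e_i` maps level `n` bijectively onto the points of the next level with `w i ≠ 0`. Where
  -- `w i = 0` the subtraction is truncated, but the weight `w i` kills the term.
  have key : ∀ i : Fin d, ∑ w ∈ level d (n + 1), (w i : ℝ) * F (w - Pi.single i 1) =
      ∑ v ∈ level d n, ((v i : ℝ) + 1) * F v := by
    intro i
    symm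
    refine Finset.sum_of_injOn (fun v => v + Pi.single i 1) (fun v _ w _ h => by simpa using h)
      (fun v hv => add_mem_level hv (single_mem_level i)) ?_ ?_
    · intro w hw hw'
      rcases Nat.eq_zero_or_pos (w i) with h | h
      · simp [h]
      · refine absurd ⟨w - Pi.single i 1, ?_, ?_⟩ hw'
        · have hle : Pi.single i 1 ≤ w := by
            intro j
            rcases eq_or_ne j i with rfl | hj
            · simpa using Nat.succ_le_of_lt h
            · simp [hj]
          have h1 := mem_level.1 hw
          have h2 : w = (w - Pi.single i 1) + Pi.single i 1 := (tsub_add_cancel_of_le hle).symm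
          rw [h2] at h1
          simp only [Pi.add_apply, Finset.sum_add_distrib] at h1
          have h3 := mem_level.1 (single_mem_level i)
          rw [Finset.mem_coe, mem_level]
          omega
        · ext j
          rcases eq_or_ne j i with rfl | hj
          · simp; omega
          · simp [hj]
    · intro v hv
      simp
  rw [Finset.sum_comm, Finset.sum_congr rfl fun i _ => key i, Finset.sum_comm, Finset.mul_sum]
  refine Finset.sum_congr rfl fun v hv => ?_
  rw [← Finset.sum_mul, Finset.sum_add_distrib]
  have := mem_level.1 hv
  simp [← this]

lemma card_level_succ (d n : ℕ) :
    ((n : ℝ) + 1) * (level d (n + 1)).card = (n + d) * (level d n).card := by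
  have h := sum_level_succ (d := d) n fun _ => 1
  simp only [mul_one, Finset.sum_const, nsmul_eq_mul] at h
  rw [← h, mul_comm, ← nsmul_eq_mul, ← Finset.sum_const]
  refine Finset.sum_congr rfl fun w hw => ?_
  have := mem_level.1 hw
  exact_mod_cast this.symm

lemma card_level (d n : ℕ) : (level (d + 1) n).card = (n + d).choose d := by
  induction n with
  | zero => simp [level_zero]
  | succ n ih =>
    have h := card_level_succ (d + 1) n
    rw [ih] at h
    have h2 := Nat.choose_mul_succ_eq (n + d) d
    rw [show n + d + 1 - d = n + 1 by omega] at h2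
    have h3 : (n + 1) * (level (d + 1) (n + 1)).card = (n + 1) * (n + d + 1).choose d := by
      rw [mul_comm _ ((n + d + 1).choose d), ← h2, mul_comm ((n + d).choose d)]
      exact_mod_cast h
    rw [Nat.eq_of_mul_eq_mul_left (Nat.succ_pos n) h3]
    congr 1
    omega

lemma card_level_pos {d : ℕ} (hd : d ≠ 0) (n : ℕ) : 0 < (level d n).card := by
  obtain ⟨e, rfl⟩ := Nat.exists_eq_succ_of_ne_zero hd
  rw [Nat.succ_eq_add_one, card_level]
  exact Nat.choose_pos (by omega)

lemma pow_le_card_level (d n : ℕ) :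
    ((n : ℝ) + 1) ^ d / d.factorial ≤ (level (d + 1) n).card := by
  rw [card_level]
  have h := Nat.pow_le_choose (α := ℝ) d (n + d)
  rw [show n + d + 1 - d = n + 1 by omega] at h
  exact_mod_cast h

open Filter Topology in
lemma tendsto_card_level_add_div {d : ℕ} (hd : d ≠ 0) (j : ℕ) :
    Tendsto (fun n => ((level d (n + j)).card : ℝ) / (level d n).card) atTop (𝓝 1) := by
  have hpos : ∀ n, (0 : ℝ) < (level d n).card := fun n => by exact_mod_cast card_level_pos hd n
  induction j with
  | zero => simp [(hpos _).ne']
  | succ j ih =>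
    -- The ratio of consecutive cardinalities is `(n + j + d) / (n + j + 1)`.
    have h1 : Tendsto (fun n : ℕ => 1 + ((d : ℝ) - 1) / (((n + j : ℕ) : ℝ) + 1)) atTop (𝓝 1) := by
      have h2 : Tendsto (fun n : ℕ => (((n + j : ℕ) : ℝ) + 1)) atTop atTop :=
        tendsto_atTop_add_const_right _ _
          (tendsto_natCast_atTop_atTop.comp (tendsto_add_atTop_nat j))
      simpa using (h2.const_div_atTop ((d : ℝ) - 1)).const_add 1
    have h := ih.mul h1
    rw [mul_one] at h
    refine h.congr fun n => ?_
    have h3 := card_level_succ d (n + j)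
    have h4 := hpos n
    have h5 : (0 : ℝ) < ((n + j : ℕ) : ℝ) + 1 := by positivity
    rw [show n + (j + 1) = n + j + 1 by omega]
    field_simp
    linarith

/-! ### Lattice paths of bounded cost -/

/-- Among the monotone lattice paths from `0`, where leaving `v` costs `c v`, there are paths to
the points of the `n`-th level whose average cost is at most the sum of the averages of `c` on the
previous levels. -/
lemma exists_cost_level {d : ℕ} (hd : d ≠ 0) {c : (Fin d → ℕ) → ℝ} (hc : ∀ v, 0 ≤ c v)
    {P : (Fin d → ℕ) → ℝ → Prop} (h0 : P 0 0)
    (hP : ∀ v t i, 0 ≤ t → P v t → P (v + Pi.single i 1) (t + c v)) (n : ℕ) :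
    ∃ V : (Fin d → ℕ) → ℝ, (∀ v ∈ level d n, P v (V v) ∧ 0 ≤ V v) ∧
      ∑ v ∈ level d n, V v ≤ (level d n).card *
        ∑ k ∈ Finset.range n, (∑ v ∈ level d k, c v) / (level d k).card := by
  induction n with
  | zero => exact ⟨fun _ => 0, by simp [level_zero, h0], by simp⟩
  | succ n ih =>
    obtain ⟨V, hV, hsum⟩ := ih
    have hex : ∀ w : Fin d → ℕ, ∃ t : ℝ, w ∈ level d (n + 1) → (P w t ∧ 0 ≤ t ∧
        (n + 1) * t ≤ ∑ i, (w i : ℝ) * (V (w - Pi.single i 1) + c (w - Pi.single i 1))) := by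
      intro w
      by_cases hw : w ∈ level d (n + 1)
      swap
      · exact ⟨0, fun h => absurd h hw⟩
      have hwn := mem_level.1 hw
      have hne : (Finset.univ.filter fun i => w i ≠ 0).Nonempty := by
        by_contra hcon
        rw [Finset.not_nonempty_iff_eq_empty, Finset.filter_eq_empty_iff] at hcon
        have : ∑ i, w i = 0 := Finset.sum_eq_zero fun i hi => by simpa using hcon hi
        omega
      -- Arrive at `w` from its cheapest predecessor. The minimum is at most the average with
      -- weights `w i / (n + 1)`, in which the missing predecessors have weight zero.
      obtain ⟨i, hi, hmin⟩ := Finset.exists_min_image _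
        (fun i => V (w - Pi.single i 1) + c (w - Pi.single i 1)) hne
      have hi0 : w i ≠ 0 := (Finset.mem_filter.1 hi).2
      have hle : w = (w - Pi.single i 1) + Pi.single i 1 := by
        ext j
        rcases eq_or_ne j i with rfl | hj
        · simp; omega
        · simp [hj]
      have hmem : w - Pi.single i 1 ∈ level d n := by
        have h1 := hwn
        rw [hle] at h1
        simp only [Pi.add_apply, Finset.sum_add_distrib] at h1
        have h3 := mem_level.1 (single_mem_level i)
        rw [mem_level]
        omega
      obtain ⟨hPv, hVv⟩ := hV _ hmem
      refine ⟨V (w - Pi.single i 1) + c (w - Pi.single i 1), fun _ => ⟨?_, ?_, ?_⟩⟩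
      · have := hP _ _ i hVv hPv
        rwa [← hle] at this
      · exact add_nonneg hVv (hc _)
      · have h1 : ((n : ℝ) + 1) = ∑ i, (w i : ℝ) := by exact_mod_cast hwn.symm
        rw [h1, Finset.sum_mul]
        refine Finset.sum_le_sum fun k _ => ?_
        by_cases hk : w k = 0
        · simp [hk]
        · exact mul_le_mul_of_nonneg_left (hmin k (by simp [hk])) (by positivity)
    choose W hW using hex
    refine ⟨W, fun v hv => ⟨(hW v hv).1, (hW v hv).2.1⟩, ?_⟩
    have hpos : ∀ n, (0 : ℝ) < (level d n).card := fun n => by exact_mod_cast card_level_pos hd n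
    have h1 : (n + 1) * ∑ w ∈ level d (n + 1), W w ≤
        (n + d) * ∑ v ∈ level d n, (V v + c v) := by
      rw [← sum_level_succ, Finset.mul_sum]
      exact Finset.sum_le_sum fun w hw => (hW w hw).2.2
    have h2 : ∑ v ∈ level d n, (V v + c v) ≤ (level d n).card *
        ∑ k ∈ Finset.range (n + 1), (∑ v ∈ level d k, c v) / (level d k).card := by
      rw [Finset.sum_range_succ, mul_add, mul_div_cancel₀ _ (hpos n).ne', Finset.sum_add_distrib]
      linarith
    -- The factor `(n + d) / (n + 1)` from the double counting is the ratio of the two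
    -- cardinalities, so the bound on sums becomes one on averages.
    have h3 := mul_le_mul_of_nonneg_left h2 (by positivity : (0 : ℝ) ≤ n + d)
    rw [← mul_assoc, ← card_level_succ, mul_assoc] at h3
    exact le_of_mul_le_mul_left (h1.trans h3) (by positivity)

/-- If the averages of `c` on the levels have bounded sums, then there are two points of `ℕ^d` that
differ by a given vector and that are both endpoints of paths of bounded cost. -/
lemma exists_pair_cost_le {d : ℕ} (hd : d ≠ 0) {c : (Fin d → ℕ) → ℝ} (hc : ∀ v, 0 ≤ c v)
    {S : ℝ} (hS : 0 < S)
    (hcS : ∀ n, ∑ k ∈ Finset.range n, (∑ v ∈ level d k, c v) / (level d k).card ≤ S)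
    {P : (Fin d → ℕ) → ℝ → Prop} (h0 : P 0 0)
    (hP : ∀ v t i, 0 ≤ t → P v t → P (v + Pi.single i 1) (t + c v)) (a b : Fin d → ℕ) :
    ∃ q, (∃ t ≤ 4 * S, P (q + a) t) ∧ ∃ t ≤ 4 * S, P (q + b) t := by
  have hpos : ∀ n, (0 : ℝ) < (level d n).card := fun n => by exact_mod_cast card_level_pos hd n
  choose V hV hsum using exists_cost_level hd hc h0 hP
  -- Markov's inequality: the average of `V n` is at most `S`.
  have hbad : ∀ n, (((level d n).filter fun v => 4 * S < V n v).card : ℝ) ≤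
      (level d n).card / 4 := by
    intro n
    have h1 : (((level d n).filter fun v => 4 * S < V n v).card : ℝ) * (4 * S) ≤
        ∑ v ∈ level d n, V n v := by
      rw [← nsmul_eq_mul, ← Finset.sum_const]
      refine (Finset.sum_le_sum fun v hv => (Finset.mem_filter.1 hv).2.le).trans ?_
      exact Finset.sum_le_sum_of_subset_of_nonneg (Finset.filter_subset _ _)
        fun v hv _ => (hV n v hv).2
    have h2 := (hsum n).trans (mul_le_mul_of_nonneg_left (hcS n) (hpos n).le)
    have h3 := h1.trans h2
    refine le_of_mul_le_mul_right (h3.trans (le_of_eq ?_)) (by positivity : (0 : ℝ) < 4 * S)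
    ring
  have hev : ∀ j, ∀ᶠ n in Filter.atTop,
      ((level d (n + j)).card : ℝ) ≤ 3 / 2 * (level d n).card := by
    intro j
    filter_upwards [(tendsto_card_level_add_div hd j).eventually_lt_const
      (by norm_num : (1 : ℝ) < 3 / 2)] with n hn
    exact ((div_lt_iff₀ (hpos n)).1 hn).le
  obtain ⟨n, hna, hnb⟩ := ((hev (∑ i, a i)).and (hev (∑ i, b i))).exists
  have hcard : ∀ e : Fin d → ℕ, ((level d (n + ∑ i, e i)).card : ℝ) ≤ 3 / 2 * (level d n).card →
      (((level d n).filter fun q => 4 * S < V (n + ∑ i, e i) (q + e)).card : ℝ) ≤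
        3 / 8 * (level d n).card := by
    intro e he
    have h1 : ((level d n).filter fun q => 4 * S < V (n + ∑ i, e i) (q + e)).card ≤
        ((level d (n + ∑ i, e i)).filter fun v => 4 * S < V (n + ∑ i, e i) v).card := by
      refine Finset.card_le_card_of_injOn (fun q => q + e) (fun q hq => ?_)
        (fun q _ r _ h => by simpa using h)
      rw [Finset.mem_coe, Finset.mem_filter] at hq ⊢
      exact ⟨add_mem_level hq.1 (mem_level.2 rfl), hq.2⟩
    have h2 := hbad (n + ∑ i, e i)
    have h3 : (((level d n).filter fun q => 4 * S < V (n + ∑ i, e i) (q + e)).card : ℝ) ≤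
        ((level d (n + ∑ i, e i)).filter fun v => 4 * S < V (n + ∑ i, e i) v).card := by
      exact_mod_cast h1
    linarith
  -- Each of the two shifts excludes at most `1/4 * 3/2 = 3/8` of the level, so together they do not
  -- exhaust it.
  have hlt : (((level d n).filter fun q => 4 * S < V (n + ∑ i, a i) (q + a)) ∪
      ((level d n).filter fun q => 4 * S < V (n + ∑ i, b i) (q + b))).card < (level d n).card := by
    have h1 := Finset.card_union_le
      ((level d n).filter fun q => 4 * S < V (n + ∑ i, a i) (q + a))
      ((level d n).filter fun q => 4 * S < V (n + ∑ i, b i) (q + b))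
    have h2 := hcard a hna
    have h3 := hcard b hnb
    have h4 := hpos n
    have h5 : ((((level d n).filter fun q => 4 * S < V (n + ∑ i, a i) (q + a)) ∪
      ((level d n).filter fun q => 4 * S < V (n + ∑ i, b i) (q + b))).card : ℝ) <
        (level d n).card := by
      refine (Nat.cast_le.2 h1).trans_lt ?_
      push_cast
      linarith
    exact_mod_cast h5
  obtain ⟨q, hq, hqn⟩ := Finset.exists_mem_notMem_of_card_lt_card hlt
  simp only [Finset.mem_union, Finset.mem_filter, hq, true_and, not_or, not_lt] at hqn
  exact ⟨q, ⟨_, hqn.1, (hV _ _ (add_mem_level hq (mem_level.2 rfl))).1⟩,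
    ⟨_, hqn.2, (hV _ _ (add_mem_level hq (mem_level.2 rfl))).1⟩⟩

/-- For a summable `ℓ ≥ 0` on `ℕ^d` and `α > 1 / d`, the averages of `ℓ ^ α` on the levels have
bounded sums. -/
lemma exists_sum_average_rpow_le {d : ℕ} (hd : 2 ≤ d) {α : ℝ} (hα : 1 / (d : ℝ) < α) (hα1 : α < 1)
    {ℓ : (Fin d → ℕ) → ℝ} (hℓ : ∀ v, 0 ≤ ℓ v) (hsum : ∀ s : Finset (Fin d → ℕ), ∑ v ∈ s, ℓ v ≤ 1) :
    ∃ S, 0 < S ∧ ∀ n, ∑ k ∈ Finset.range n,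
      (∑ v ∈ level d k, ℓ v ^ α) / (level d k).card ≤ S := by
  obtain ⟨e, rfl⟩ : ∃ e, d = e + 1 := ⟨d - 1, by omega⟩
  have he : (1 : ℝ) ≤ e := by exact_mod_cast (by omega : 1 ≤ e)
  have hα0 : 0 < α := lt_trans (by positivity) hα
  have h1α : 0 < 1 - α := by linarith
  have hpos : ∀ n, (0 : ℝ) < (level (e + 1) n).card :=
    fun n => by exact_mod_cast card_level_pos (by omega) n
  set β : ℝ := α / (1 - α) with hβ
  have hβ0 : 0 < β := div_pos hα0 h1α
  -- With `d = e + 1` this is `α > 1 / d` rearranged; it makes `(k + 1) ^ (-(e * β))` summable.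
  have hexp : 1 < e * β := by
    rw [hβ, ← mul_div_assoc, lt_div_iff₀ h1α]
    rw [div_lt_iff₀ (by positivity)] at hα
    push_cast at hα
    linarith
  have hsummable : Summable fun k : ℕ => ((level (e + 1) k).card : ℝ) ^ (-β) := by
    have h1 : Summable fun k : ℕ => (((k + 1 : ℕ) : ℝ) ^ (-(e * β))) :=
      (summable_nat_add_iff 1).2 (Real.summable_nat_rpow.2 (by linarith))
    refine Summable.of_nonneg_of_le (fun k => by positivity) (fun k => ?_)
      (h1.mul_left ((e.factorial : ℝ) ^ β))
    have h2 := pow_le_card_level e k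
    have h3 := Real.rpow_le_rpow_of_nonpos (by positivity) h2 (neg_nonpos.2 hβ0.le)
    refine h3.trans (le_of_eq ?_)
    rw [Real.div_rpow (by positivity) (by positivity), ← Real.rpow_natCast, ← Real.rpow_mul
      (by positivity), Real.rpow_neg (by positivity) β, div_inv_eq_mul, mul_comm]
    push_cast
    ring_nf
  refine ⟨1 + ∑' k : ℕ, ((level (e + 1) k).card : ℝ) ^ (-β), ?_, fun n => ?_⟩
  · have : 0 ≤ ∑' k : ℕ, ((level (e + 1) k).card : ℝ) ^ (-β) := tsum_nonneg fun k => by positivity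
    linarith
  have hterm : ∀ k, (∑ v ∈ level (e + 1) k, ℓ v ^ α) / (level (e + 1) k).card ≤
      ∑ v ∈ level (e + 1) k, ℓ v + ((level (e + 1) k).card : ℝ) ^ (-β) := by
    intro k
    have hN := hpos k
    have hv : ∀ v ∈ level (e + 1) k, ℓ v ^ α / (level (e + 1) k).card ≤
        ℓ v + ((level (e + 1) k).card : ℝ) ^ (-β) / (level (e + 1) k).card := by
      intro v _
      -- Young's inequality for `ℓ v ^ α * N⁻¹`, with `N` the cardinality of the level and `N⁻¹`
      -- written as `(N ^ (-1 / (1 - α))) ^ (1 - α)`.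
      have hy := Real.geom_mean_le_arith_mean2_weighted hα0.le h1α.le (hℓ v)
        (by positivity : 0 ≤ ((level (e + 1) k).card : ℝ) ^ (-(1 / (1 - α)))) (by ring)
      rw [← Real.rpow_mul hN.le, neg_mul, one_div_mul_cancel h1α.ne', Real.rpow_neg_one] at hy
      have h1 : ((level (e + 1) k).card : ℝ) ^ (-(1 / (1 - α))) =
          ((level (e + 1) k).card : ℝ) ^ (-β) / (level (e + 1) k).card := by
        rw [← Real.rpow_sub_one hN.ne']
        congr 1
        rw [hβ]
        field_simp
        ring
      rw [h1] at hy
      have h2 : 0 ≤ ((level (e + 1) k).card : ℝ) ^ (-β) / (level (e + 1) k).card := by positivity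
      rw [div_eq_mul_inv]
      refine hy.trans (add_le_add ?_ ?_)
      · exact mul_le_of_le_one_left (hℓ v) hα1.le
      · exact mul_le_of_le_one_left h2 (by linarith)
    rw [Finset.sum_div]
    refine (Finset.sum_le_sum hv).trans (le_of_eq ?_)
    rw [Finset.sum_add_distrib, Finset.sum_const, nsmul_eq_mul, mul_div_cancel₀ _ hN.ne']
  refine (Finset.sum_le_sum fun k _ => hterm k).trans ?_
  rw [Finset.sum_add_distrib]
  refine add_le_add ?_ (hsummable.sum_le_tsum _ fun k _ => by positivity)
  rw [← Finset.sum_biUnion]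
  · exact hsum _
  · intro k _ l _ hkl
    rw [Function.onFun, Finset.disjoint_left]
    intro v hk hl
    exact hkl ((mem_level.1 hk).symm.trans (mem_level.1 hl))

/-! ### Distortion of Hölder diffeomorphisms -/

lemma IsDiffHolder.mono_exponent {α β : ℝ} {f : unitInterval ≃ₜ unitInterval} (hβ : 0 < β)
    (hβα : β ≤ α) (hf : IsDiffHolder α f) : IsDiffHolder β f := by
  obtain ⟨hmono, f', hf', C, hC, hCf⟩ := hf
  refine ⟨hmono, f', hf', C, hC, fun x y => (hCf x y).trans ?_⟩
  refine mul_le_mul_of_nonneg_left ?_ hC.le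
  have h1 : |(x : ℝ) - y| ≤ 1 := abs_sub_le_iff.2
    ⟨by linarith [x.2.2, y.2.1], by linarith [x.2.1, y.2.2]⟩
  exact Real.rpow_le_rpow_of_exponent_ge_of_imp (abs_nonneg _) h1 hβα
    fun _ h => absurd h (hβ.trans_le hβα).ne'

/-- The distortion of `f` between the intervals `[x₁, x₂]` and `[y₁, y₂]` contained in `[s, t]` is
at most `E`. -/
def DistortionLE (f : unitInterval ≃ₜ unitInterval) (s t : unitInterval) (E : ℝ) : Prop :=
  ∀ x₁ ∈ Set.Icc s t, ∀ x₂ ∈ Set.Icc s t, ∀ y₁ ∈ Set.Icc s t, ∀ y₂ ∈ Set.Icc s t,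
    x₁ ≤ x₂ → y₁ ≤ y₂ →
    ((f x₂ : ℝ) - f x₁) * ((y₂ : ℝ) - y₁) ≤ E * (((f y₂ : ℝ) - f y₁) * ((x₂ : ℝ) - x₁))

lemma DistortionLE.mono {f : unitInterval ≃ₜ unitInterval} {s t : unitInterval} {E E' : ℝ}
    (hf : StrictMono f) (h : DistortionLE f s t E) (hE : E ≤ E') : DistortionLE f s t E' := by
  intro x₁ hx₁ x₂ hx₂ y₁ hy₁ y₂ hy₂ hx hy
  refine (h x₁ hx₁ x₂ hx₂ y₁ hy₁ y₂ hy₂ hx hy).trans (mul_le_mul_of_nonneg_right hE ?_)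
  exact mul_nonneg (sub_nonneg.2 (hf.monotone hy)) (sub_nonneg.2 hx)

lemma DistortionLE.one (s t : unitInterval) : DistortionLE 1 s t 1 := by
  intro x₁ hx₁ x₂ hx₂ y₁ hy₁ y₂ hy₂ hx hy
  simp only [Homeomorph.one_apply]
  linarith

lemma DistortionLE.mul {f g : unitInterval ≃ₜ unitInterval} {s t : unitInterval} {E E' : ℝ}
    (hf : StrictMono f) (hg : StrictMono g) (hE' : 0 ≤ E') (h : DistortionLE g s t E)
    (h' : DistortionLE f (g s) (g t) E') : DistortionLE (f * g) s t (E' * E) := by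
  intro x₁ hx₁ x₂ hx₂ y₁ hy₁ y₂ hy₂ hx hy
  simp only [Homeomorph.mul_apply]
  have hmem : ∀ z ∈ Set.Icc s t, g z ∈ Set.Icc (g s) (g t) :=
    fun z hz => ⟨hg.monotone hz.1, hg.monotone hz.2⟩
  have h1 := h x₁ hx₁ x₂ hx₂ y₁ hy₁ y₂ hy₂ hx hy
  have h2 := h' _ (hmem _ hx₁) _ (hmem _ hx₂) _ (hmem _ hy₁) _ (hmem _ hy₂)
    (hg.monotone hx) (hg.monotone hy)
  rcases hy.eq_or_lt with rfl | hlt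
  · simp
  have hY : (0 : ℝ) < (g y₂ : ℝ) - g y₁ := sub_pos.2 (hg hlt)
  have hy0 : (0 : ℝ) < (y₂ : ℝ) - y₁ := sub_pos.2 hlt
  have hF : (0 : ℝ) ≤ (f (g y₂) : ℝ) - f (g y₁) := sub_nonneg.2 (hf.monotone (hg.monotone hy))
  refine le_of_mul_le_mul_right ?_ hY
  calc _ = (((f (g x₂) : ℝ) - f (g x₁)) * ((g y₂ : ℝ) - g y₁)) * ((y₂ : ℝ) - y₁) := by ring
    _ ≤ (E' * (((f (g y₂) : ℝ) - f (g y₁)) * ((g x₂ : ℝ) - g x₁))) * ((y₂ : ℝ) - y₁) :=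
        mul_le_mul_of_nonneg_right h2 hy0.le
    _ = (E' * ((f (g y₂) : ℝ) - f (g y₁))) * (((g x₂ : ℝ) - g x₁) * ((y₂ : ℝ) - y₁)) := by ring
    _ ≤ (E' * ((f (g y₂) : ℝ) - f (g y₁))) * (E * (((g y₂ : ℝ) - g y₁) * ((x₂ : ℝ) - x₁))) :=
        mul_le_mul_of_nonneg_left h1 (mul_nonneg hE' hF)
    _ = _ := by ring

lemma exists_hasDeriv_eq_slope {f : unitInterval ≃ₜ unitInterval} {f' : unitInterval → ℝ}
    (hf' : ∀ x : unitInterval, HasDerivWithinAt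
        (Set.IccExtend (zero_le_one : (0 : ℝ) ≤ 1) (fun t : unitInterval => (f t : ℝ)))
        (f' x) (Set.Icc (0 : ℝ) 1) (x : ℝ)) {x y : unitInterval} (hxy : x < y) :
    ∃ c ∈ Set.Icc x y, (f y : ℝ) - f x = f' c * ((y : ℝ) - x) := by
  have hlt : (x : ℝ) < y := hxy
  obtain ⟨c, hc, hcs⟩ := exists_hasDerivAt_eq_slope
    (Set.IccExtend (zero_le_one : (0 : ℝ) ≤ 1) (fun t : unitInterval => (f t : ℝ)))
    (Set.IccExtend (zero_le_one : (0 : ℝ) ≤ 1) f') hlt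
    ((continuous_subtype_val.comp f.continuous).Icc_extend').continuousOn
    (fun z hz => by
      have hz' : z ∈ Set.Ioo (0 : ℝ) 1 := ⟨x.2.1.trans_lt hz.1, hz.2.trans_le y.2.2⟩
      rw [Set.IccExtend_of_mem _ _ (Set.Ioo_subset_Icc_self hz')]
      exact (hf' ⟨z, Set.Ioo_subset_Icc_self hz'⟩).hasDerivAt (Icc_mem_nhds hz'.1 hz'.2))
  have hc' : c ∈ Set.Icc (0 : ℝ) 1 := ⟨x.2.1.trans hc.1.le, hc.2.le.trans y.2.2⟩
  refine ⟨⟨c, hc'⟩, ⟨hc.1.le, hc.2.le⟩, ?_⟩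
  rw [Set.IccExtend_of_mem _ _ hc', Set.IccExtend_val, Set.IccExtend_val] at hcs
  rw [hcs, div_mul_cancel₀ _ (sub_pos.2 hlt).ne']

/-- By the mean value theorem distortion is a ratio of two values of `f'`, controlled by the Hölder
bound and the positive minimum of `f'`. Allowing every larger `C'` lets finitely many maps share one
constant. -/
lemma IsDiffHolder.exists_distortionLE {α : ℝ} (hα : 0 < α) {f : unitInterval ≃ₜ unitInterval}
    (hf : IsDiffHolder α f) :
    ∃ C : ℝ, ∀ C' ≥ C, ∀ s t : unitInterval, s ≤ t →
      DistortionLE f s t (Real.exp (C' * ((t : ℝ) - s) ^ α)) := by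
  obtain ⟨hmono, f', hf', C, hC, hCf⟩ := hf
  have hcont : Continuous f' := by
    rw [continuous_iff_continuousAt]
    intro x
    rw [ContinuousAt, tendsto_iff_dist_tendsto_zero]
    have h1 : Filter.Tendsto (fun y : unitInterval => C * |(y : ℝ) - x| ^ α) (nhds x) (nhds 0) := by
      have h2 : Continuous fun y : unitInterval => C * |(y : ℝ) - x| ^ α :=
        continuous_const.mul ((continuous_subtype_val.sub continuous_const).abs.rpow_const
          fun _ => Or.inr hα.le)
      have h3 := h2.tendsto x
      simpa [Real.zero_rpow hα.ne'] using h3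
    exact squeeze_zero (fun y => dist_nonneg) (fun y => by rw [Real.dist_eq]; exact hCf y x) h1
  obtain ⟨z, -, hz⟩ := isCompact_univ.exists_isMinOn Set.univ_nonempty hcont.continuousOn
  have hm : 0 < f' z := (hf' z).1
  refine ⟨C / f' z, fun C' hC' s t hst => ?_⟩
  have hslope : ∀ p ∈ Set.Icc s t, ∀ q ∈ Set.Icc s t, p ≤ q →
      ∃ c ∈ Set.Icc s t, (f q : ℝ) - f p = f' c * ((q : ℝ) - p) := by
    intro p hp q hq hpq
    rcases hpq.eq_or_lt with rfl | hlt
    · exact ⟨p, hp, by simp⟩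
    · obtain ⟨c, hc, h⟩ := exists_hasDeriv_eq_slope (fun x => (hf' x).2) hlt
      exact ⟨c, ⟨hp.1.trans hc.1, hc.2.trans hq.2⟩, h⟩
  intro x₁ hx₁ x₂ hx₂ y₁ hy₁ y₂ hy₂ hx hy
  obtain ⟨a, ha, hfa⟩ := hslope x₁ hx₁ x₂ hx₂ hx
  obtain ⟨b, hb, hfb⟩ := hslope y₁ hy₁ y₂ hy₂ hy
  have hab : f' a ≤ Real.exp (C' * ((t : ℝ) - s) ^ α) * f' b := by
    have h1 : |(a : ℝ) - b| ≤ (t : ℝ) - s := by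
      have h1 : (s : ℝ) ≤ a := ha.1
      have h2 : (a : ℝ) ≤ t := ha.2
      have h3 : (s : ℝ) ≤ b := hb.1
      have h4 : (b : ℝ) ≤ t := hb.2
      exact abs_sub_le_iff.2 ⟨by linarith, by linarith⟩
    have h2 : |(a : ℝ) - b| ^ α ≤ ((t : ℝ) - s) ^ α := Real.rpow_le_rpow (abs_nonneg _) h1 hα.le
    have h3 : f' z ≤ f' b := hz (Set.mem_univ b)
    have h4 : f' a - f' b ≤ C * ((t : ℝ) - s) ^ α :=
      (le_abs_self _).trans ((hCf a b).trans (mul_le_mul_of_nonneg_left h2 hC.le))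
    have h5 : 0 ≤ ((t : ℝ) - s) ^ α := (Real.rpow_nonneg (abs_nonneg _) _).trans h2
    have h6 := Real.add_one_le_exp (C' * ((t : ℝ) - s) ^ α)
    have h7 : C ≤ C' * f' b :=
      ((div_le_iff₀ hm).1 hC').trans
        (mul_le_mul_of_nonneg_left h3 ((by positivity : 0 ≤ C / f' z).trans hC'))
    calc f' a ≤ C * ((t : ℝ) - s) ^ α + f' b := by linarith
      _ ≤ C' * f' b * ((t : ℝ) - s) ^ α + f' b := by gcongr
      _ = (C' * ((t : ℝ) - s) ^ α + 1) * f' b := by ring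
      _ ≤ _ := mul_le_mul_of_nonneg_right h6 (hf' b).1.le
  rw [hfa, hfb]
  have hx0 : (0 : ℝ) ≤ (x₂ : ℝ) - x₁ := sub_nonneg.2 hx
  have hy0 : (0 : ℝ) ≤ (y₂ : ℝ) - y₁ := sub_nonneg.2 hy
  have := mul_le_mul_of_nonneg_right hab (mul_nonneg hx0 hy0)
  nlinarith

/-! ### Fibres of the semiconjugacy -/

/-- A group `G` of increasing homeomorphisms of `[0,1]` together with a semiconjugacy `φ` of its
action on `(0,1)` to a free action of `ℤ^d` by translations. -/
structure TranslationSemiconj (d : ℕ) (G : Subgroup (unitInterval ≃ₜ unitInterval)) where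
  ρ : G →* Multiplicative (Fin d → ℤ)
  τ : (Fin d → ℤ) →+ ℝ
  φ : unitInterval → ℝ
  strictMono : ∀ g : G, StrictMono (g : unitInterval ≃ₜ unitInterval)
  surjective : Function.Surjective ρ
  free : IsFreeTranslationAction τ
  continuousOn : ContinuousOn φ (Set.Ioo 0 1)
  monotoneOn : MonotoneOn φ (Set.Ioo 0 1)
  surjOn : Set.SurjOn φ (Set.Ioo 0 1) Set.univ
  map_apply : ∀ (g : G), ∀ x ∈ Set.Ioo (0 : unitInterval) 1,
    φ ((g : unitInterval ≃ₜ unitInterval) x) = φ x + τ (Multiplicative.toAdd (ρ g))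

lemma StrictMono.homeomorph_zero {f : unitInterval ≃ₜ unitInterval} (hf : StrictMono f) :
    f 0 = 0 := by
  obtain ⟨x, hx⟩ := f.surjective 0
  exact le_antisymm ((hf.monotone unitInterval.nonneg').trans_eq hx) unitInterval.nonneg'

lemma StrictMono.homeomorph_one {f : unitInterval ≃ₜ unitInterval} (hf : StrictMono f) :
    f 1 = 1 := by
  obtain ⟨x, hx⟩ := f.surjective 1
  exact le_antisymm unitInterval.le_one' (hx.symm.trans_le (hf.monotone unitInterval.le_one'))

lemma StrictMono.homeomorph_mem_Ioo {f : unitInterval ≃ₜ unitInterval} (hf : StrictMono f)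
    {x : unitInterval} : f x ∈ Set.Ioo 0 1 ↔ x ∈ Set.Ioo 0 1 := by
  have h0 := hf.lt_iff_lt (a := 0) (b := x)
  have h1 := hf.lt_iff_lt (a := x) (b := 1)
  rw [hf.homeomorph_zero] at h0
  rw [hf.homeomorph_one] at h1
  exact and_congr h0 h1

namespace TranslationSemiconj

variable {d : ℕ} {G : Subgroup (unitInterval ≃ₜ unitInterval)} (T : TranslationSemiconj d G)

lemma τ_injective : Function.Injective T.τ :=
  (injective_iff_map_eq_zero _).2 fun v hv => T.free v 0 (by simp [hv])

/-- A subgroup of the line is dense or cyclic, and a cyclic group has no room for two independent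
generators. -/
lemma dense_range_τ (hd : 2 ≤ d) : Dense (Set.range T.τ) := by
  rcases AddSubgroup.dense_or_cyclic T.τ.range with h | ⟨c, hc⟩
  · simpa using h
  exfalso
  have hmem : ∀ v, ∃ n : ℤ, n • c = T.τ v := fun v => by
    have : T.τ v ∈ T.τ.range := ⟨v, rfl⟩
    rw [hc] at this
    exact AddSubgroup.mem_closure_singleton.1 this
  let i : Fin d := ⟨0, by omega⟩
  let j : Fin d := ⟨1, by omega⟩
  have hij : i ≠ j := by simp [i, j]
  obtain ⟨m, hm⟩ := hmem (Pi.single i 1)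
  obtain ⟨n, hn⟩ := hmem (Pi.single j 1)
  have h1 : n • Pi.single i (1 : ℤ) = m • Pi.single j (1 : ℤ) := T.τ_injective <| by
    rw [map_zsmul, map_zsmul, ← hm, ← hn, smul_smul, smul_smul, mul_comm]
  have h2 : m = 0 := by simpa [hij] using (congrFun h1 j).symm
  rw [h2, zero_smul] at hm
  have h3 := congrFun (T.τ_injective (hm.symm.trans (map_zero T.τ).symm)) i
  simp at h3

lemma exists_τ_mem_Ioo (hd : 2 ≤ d) {r s : ℝ} (hrs : r < s) : ∃ v, T.τ v ∈ Set.Ioo r s := by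
  obtain ⟨_, h, v, rfl⟩ := (T.dense_range_τ hd).inter_open_nonempty _ isOpen_Ioo (Set.nonempty_Ioo.2 hrs)
  exact ⟨v, h⟩

lemma exists_ρ_eq (v : Fin d → ℤ) : ∃ g : G, Multiplicative.toAdd (T.ρ g) = v :=
  (T.surjective (Multiplicative.ofAdd v)).imp fun g hg => by rw [hg, toAdd_ofAdd]

lemma lt_of_φ_lt {x y : unitInterval} (hx : x ∈ Set.Ioo 0 1) (hy : y ∈ Set.Ioo 0 1)
    (h : T.φ x < T.φ y) : x < y :=
  lt_of_not_ge fun hle => h.not_ge (T.monotoneOn hy hx hle)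

/-- The fibre of `φ` over `r`. -/
def fiber (r : ℝ) : Set unitInterval := {x | x ∈ Set.Ioo 0 1 ∧ T.φ x = r}

/-- Points over `r - 1` and `r + 1` keep the fibre away from `0` and `1`, where nothing is known
about `φ`. -/
lemma isCompact_fiber (r : ℝ) : IsCompact (T.fiber r) := by
  obtain ⟨p, hp, hpr⟩ := T.surjOn (Set.mem_univ (r - 1))
  obtain ⟨q, hq, hqr⟩ := T.surjOn (Set.mem_univ (r + 1))
  have hsub : Set.Icc p q ⊆ Set.Ioo 0 1 := fun x hx => ⟨hp.1.trans_le hx.1, hx.2.trans_lt hq.2⟩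
  have h : T.fiber r = Set.Icc p q ∩ T.φ ⁻¹' {r} := by
    ext x
    refine ⟨fun hx => ⟨⟨?_, ?_⟩, hx.2⟩, fun hx => ⟨hsub hx.1, hx.2⟩⟩
    · exact (T.lt_of_φ_lt hp hx.1 (by rw [hpr, hx.2]; linarith)).le
    · exact (T.lt_of_φ_lt hx.1 hq (by rw [hqr, hx.2]; linarith)).le
  rw [h]
  exact isCompact_Icc.of_isClosed_subset
    ((T.continuousOn.mono hsub).preimage_isClosed_of_isClosed isClosed_Icc isClosed_singleton)
    Set.inter_subset_left

lemma fiber_nonempty (r : ℝ) : (T.fiber r).Nonempty := T.surjOn (Set.mem_univ r)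

lemma exists_isLeast_fiber (r : ℝ) : ∃ x, IsLeast (T.fiber r) x :=
  (T.isCompact_fiber r).exists_isLeast (T.fiber_nonempty r)

lemma exists_isGreatest_fiber (r : ℝ) : ∃ x, IsGreatest (T.fiber r) x :=
  (T.isCompact_fiber r).exists_isGreatest (T.fiber_nonempty r)

/-- The least point of the fibre over `r`. -/
noncomputable def lower (r : ℝ) : unitInterval := (T.exists_isLeast_fiber r).choose

/-- The greatest point of the fibre over `r`. -/
noncomputable def upper (r : ℝ) : unitInterval := (T.exists_isGreatest_fiber r).choose

lemma isLeast_lower (r : ℝ) : IsLeast (T.fiber r) (T.lower r) :=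
  (T.exists_isLeast_fiber r).choose_spec

lemma isGreatest_upper (r : ℝ) : IsGreatest (T.fiber r) (T.upper r) :=
  (T.exists_isGreatest_fiber r).choose_spec

lemma lower_le_upper (r : ℝ) : T.lower r ≤ T.upper r :=
  (T.isLeast_lower r).2 (T.isGreatest_upper r).1

lemma upper_lt_lower {r s : ℝ} (hrs : r < s) : T.upper r < T.lower s :=
  T.lt_of_φ_lt (T.isGreatest_upper r).1.1 (T.isLeast_lower s).1.1
    (by rw [(T.isGreatest_upper r).1.2, (T.isLeast_lower s).1.2]; exact hrs)

lemma apply_mem_fiber (g : G) {r : ℝ} {x : unitInterval} :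
    (g : unitInterval ≃ₜ unitInterval) x ∈ T.fiber (r + T.τ (Multiplicative.toAdd (T.ρ g))) ↔
      x ∈ T.fiber r := by
  refine (and_congr_left' (T.strictMono g).homeomorph_mem_Ioo).trans (and_congr_right fun hx => ?_)
  rw [T.map_apply g x hx, add_left_inj]

lemma apply_lower (g : G) (r : ℝ) :
    (g : unitInterval ≃ₜ unitInterval) (T.lower r) =
      T.lower (r + T.τ (Multiplicative.toAdd (T.ρ g))) := by
  refine IsLeast.unique ⟨(T.apply_mem_fiber g).2 (T.isLeast_lower r).1, fun y hy => ?_⟩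
    (T.isLeast_lower _)
  obtain ⟨x, rfl⟩ := (g : unitInterval ≃ₜ unitInterval).surjective y
  exact (T.strictMono g).monotone ((T.isLeast_lower r).2 ((T.apply_mem_fiber g).1 hy))

lemma apply_upper (g : G) (r : ℝ) :
    (g : unitInterval ≃ₜ unitInterval) (T.upper r) =
      T.upper (r + T.τ (Multiplicative.toAdd (T.ρ g))) := by
  refine IsGreatest.unique ⟨(T.apply_mem_fiber g).2 (T.isGreatest_upper r).1, fun y hy => ?_⟩
    (T.isGreatest_upper _)
  obtain ⟨x, rfl⟩ := (g : unitInterval ≃ₜ unitInterval).surjective y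
  exact (T.strictMono g).monotone ((T.isGreatest_upper r).2 ((T.apply_mem_fiber g).1 hy))

/-- The length of the fibre over `r`. -/
noncomputable def length (r : ℝ) : ℝ := (T.upper r : ℝ) - T.lower r

lemma length_nonneg (r : ℝ) : 0 ≤ T.length r := sub_nonneg.2 (T.lower_le_upper r)

lemma sum_length_le_one (s : Finset ℝ) : ∑ r ∈ s, T.length r ≤ 1 := by
  have hdisj : (s : Set ℝ).PairwiseDisjoint
      fun r => Set.Icc (T.lower r : ℝ) (T.upper r) := by
    intro r _ t _ hrt
    rw [Function.onFun, Set.disjoint_left]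
    intro x hr ht
    rcases lt_or_gt_of_ne hrt with h | h
    · have : (T.upper r : ℝ) < T.lower t := T.upper_lt_lower h
      linarith [hr.2, ht.1]
    · have : (T.upper t : ℝ) < T.lower r := T.upper_lt_lower h
      linarith [ht.2, hr.1]
  have h1 : MeasureTheory.volume (⋃ r ∈ s, Set.Icc (T.lower r : ℝ) (T.upper r)) =
      ENNReal.ofReal (∑ r ∈ s, T.length r) := by
    rw [MeasureTheory.measure_biUnion_finset hdisj fun _ _ => measurableSet_Icc,
      ENNReal.ofReal_sum_of_nonneg fun r _ => T.length_nonneg r]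
    exact Finset.sum_congr rfl fun r _ => Real.volume_Icc
  have h2 : (⋃ r ∈ s, Set.Icc (T.lower r : ℝ) (T.upper r)) ⊆ Set.Icc 0 1 :=
    Set.iUnion₂_subset fun r _ => Set.Icc_subset_Icc (T.lower r).2.1 (T.upper r).2.2
  have h3 := MeasureTheory.measure_mono (μ := MeasureTheory.volume) h2
  rw [h1, Real.volume_Icc] at h3
  simpa using (ENNReal.ofReal_le_ofReal_iff (by norm_num)).1 h3

/-! ### Absence of wandering intervals -/

/-- The generators of `ℤ^d` lift to elements of `G` with a common bound on their distortion. -/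
lemma exists_lift_distortionLE {α : ℝ} (hα : 0 < α) (hG : ∀ g ∈ G, IsDiffHolder α g) :
    ∃ (f : Fin d → G) (C : ℝ), 0 ≤ C ∧ (∀ i, Multiplicative.toAdd (T.ρ (f i)) = Pi.single i 1) ∧
      ∀ i, ∀ s t : unitInterval, s ≤ t →
        DistortionLE (f i : unitInterval ≃ₜ unitInterval) s t
          (Real.exp (C * ((t : ℝ) - s) ^ α)) := by
  choose f hf using fun i : Fin d => T.exists_ρ_eq (Pi.single i 1)
  choose C hC using fun i => (hG (f i) (f i).2).exists_distortionLE hα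
  refine ⟨f, ∑ i, |C i|, Finset.sum_nonneg fun i _ => abs_nonneg _, hf, fun i => hC i _ ?_⟩
  exact (le_abs_self _).trans
    (Finset.single_le_sum (f := fun i => |C i|) (fun i _ => abs_nonneg _) (Finset.mem_univ i))

/-- If `g` has small distortion on a small neighbourhood `[p, q]` of the fibre over `s`, then it
contracts the other fibres in this neighbourhood by a definite factor compared with that fibre. -/
lemma length_add_le {s E : ℝ} (hs : 0 < T.length s) (hE : 0 < E) {p q : unitInterval}
    (hp0 : 0 < p) (hp : (T.lower s : ℝ) - p ≤ T.length s / (4 * E))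
    (hq1 : q < 1) (hq : (q : ℝ) - T.upper s ≤ T.length s / (4 * E))
    {g : G} (hps : p < T.lower s) (hsq : T.upper s < q)
    (hg : DistortionLE (g : unitInterval ≃ₜ unitInterval) p q E) {r : ℝ} (hrs : r ≠ s)
    (hr : r ∈ Set.Ioo (T.φ p) (T.φ q)) :
    T.length (r + T.τ (Multiplicative.toAdd (T.ρ g))) ≤
      T.length (s + T.τ (Multiplicative.toAdd (T.ρ g))) / 4 := by
  have hpq : p < q := hps.trans ((T.lower_le_upper s).trans_lt hsq)
  have hpI : p ∈ Set.Ioo 0 1 := ⟨hp0, hpq.trans hq1⟩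
  have hqI : q ∈ Set.Ioo 0 1 := ⟨hp0.trans hpq, hq1⟩
  have h1 : p ≤ T.lower r := (T.lt_of_φ_lt hpI (T.isLeast_lower r).1.1
    (by rw [(T.isLeast_lower r).1.2]; exact hr.1)).le
  have h2 : T.upper r ≤ q := (T.lt_of_φ_lt (T.isGreatest_upper r).1.1 hqI
    (by rw [(T.isGreatest_upper r).1.2]; exact hr.2)).le
  have h3 := hg (T.lower r) ⟨h1, (T.lower_le_upper r).trans h2⟩ (T.upper r)
    ⟨h1.trans (T.lower_le_upper r), h2⟩ (T.lower s) ⟨hps.le, (T.lower_le_upper s).trans hsq.le⟩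
    (T.upper s) ⟨hps.le.trans (T.lower_le_upper s), hsq.le⟩ (T.lower_le_upper r)
    (T.lower_le_upper s)
  rw [T.apply_lower, T.apply_lower, T.apply_upper, T.apply_upper] at h3
  -- The fibre over `r` lies in one of the two flanks of the fibre over `s` in `[p, q]`.
  have h4 : T.length r ≤ T.length s / (4 * E) := by
    have h1' : (p : ℝ) ≤ T.lower r := h1
    have h2' : (T.upper r : ℝ) ≤ q := h2
    rcases lt_or_gt_of_ne hrs with h | h
    · have : (T.upper r : ℝ) < T.lower s := T.upper_lt_lower h
      change (T.upper r : ℝ) - T.lower r ≤ _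
      linarith
    · have : (T.upper s : ℝ) < T.lower r := T.upper_lt_lower h
      change (T.upper r : ℝ) - T.lower r ≤ _
      linarith
  set b := T.τ (Multiplicative.toAdd (T.ρ g))
  have h5 : T.length (r + b) * T.length s ≤ E * (T.length (s + b) * T.length r) := h3
  refine le_of_mul_le_mul_right (h5.trans ?_) hs
  calc E * (T.length (s + b) * T.length r)
      ≤ E * (T.length (s + b) * (T.length s / (4 * E))) := by
        gcongr
        exact T.length_nonneg _
    _ = T.length (s + b) / 4 * T.length s := by field_simp

/-- If `g` has small distortion on a small neighbourhood `[p, q]` of the fibre over `s`, then the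
image of this neighbourhood is at most twice as long as that of the fibre. -/
lemma apply_sub_apply_le {s E : ℝ} (hs : 0 < T.length s) (hE : 0 < E) {p q : unitInterval}
    (hp : (T.lower s : ℝ) - p ≤ T.length s / (4 * E))
    (hq : (q : ℝ) - T.upper s ≤ T.length s / (4 * E))
    {g : G} (hps : p < T.lower s) (hsq : T.upper s < q)
    (hg : DistortionLE (g : unitInterval ≃ₜ unitInterval) p q E) :
    ((g : unitInterval ≃ₜ unitInterval) q : ℝ) - (g : unitInterval ≃ₜ unitInterval) p ≤
      2 * T.length (s + T.τ (Multiplicative.toAdd (T.ρ g))) := by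
  have hab := T.lower_le_upper s
  have hpm : p ∈ Set.Icc p q := ⟨le_rfl, (hps.trans (hab.trans_lt hsq)).le⟩
  have hqm : q ∈ Set.Icc p q := ⟨hpm.2, le_rfl⟩
  have ham : T.lower s ∈ Set.Icc p q := ⟨hps.le, hab.trans hsq.le⟩
  have hbm : T.upper s ∈ Set.Icc p q := ⟨hps.le.trans hab, hsq.le⟩
  have h1 := hg p hpm _ ham _ ham _ hbm hps.le hab
  have h2 := hg _ hbm q hqm _ ham _ hbm hsq.le hab
  rw [T.apply_lower, T.apply_upper] at h1 h2
  set b := T.τ (Multiplicative.toAdd (T.ρ g))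
  have key : ∀ x y : ℝ, x * T.length s ≤ E * (T.length (s + b) * y) →
      y ≤ T.length s / (4 * E) → x ≤ T.length (s + b) / 4 := by
    intro x y hx hy
    refine le_of_mul_le_mul_right (hx.trans ?_) hs
    calc E * (T.length (s + b) * y)
        ≤ E * (T.length (s + b) * (T.length s / (4 * E))) := by
          gcongr
          exact T.length_nonneg _
      _ = T.length (s + b) / 4 * T.length s := by field_simp
  -- Each flank has image at most a quarter as long as that of the fibre, for a total factor of
  -- `3/2`.
  have h3 := key _ _ h1 hp
  have h4 := key _ _ h2 hq
  have h5 := T.length_nonneg (s + b)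
  have h6 : T.length (s + b) = T.upper (s + b) - T.lower (s + b) := rfl
  linarith

/-- For `α > 1 / d` there are no wandering intervals. -/
theorem length_eq_zero (hd : 2 ≤ d) {α : ℝ} (hα : 1 / (d : ℝ) < α) (hα1 : α < 1)
    (hG : ∀ g ∈ G, IsDiffHolder α g) (s : ℝ) : T.length s = 0 := by
  by_contra hne
  have hs : 0 < T.length s := lt_of_le_of_ne (T.length_nonneg s) (Ne.symm hne)
  have hα0 : 0 < α := lt_trans (by positivity) hα
  let ι : (Fin d → ℕ) → Fin d → ℤ := fun v i => v i
  have hι : Function.Injective ι := fun v w h => funext fun i => Int.ofNat_injective (congrFun h i)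
  have hsum : ∀ A : Finset (Fin d → ℕ), ∑ v ∈ A, T.length (s + T.τ (ι v)) ≤ 1 := by
    intro A
    have hinj : Function.Injective fun v => s + T.τ (ι v) :=
      (add_right_injective s).comp (T.τ_injective.comp hι)
    exact (Finset.sum_map A ⟨_, hinj⟩ T.length).symm.trans_le (T.sum_length_le_one _)
  obtain ⟨S, hS, hcS⟩ := exists_sum_average_rpow_le hd hα hα1
    (fun v => T.length_nonneg (s + T.τ (ι v))) hsum
  obtain ⟨f, C, hC, hρf, hf⟩ := T.exists_lift_distortionLE hα0 hG
  have hB : 0 ≤ C * 2 ^ α := by positivity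
  -- The `2` is the factor in `apply_sub_apply_le`; `E` bounds the distortion accumulated over the
  -- whole budget `4 * S`.
  set B := C * 2 ^ α with hBdef
  set E := Real.exp (B * (4 * S)) with hEdef
  have hE : 0 < E := Real.exp_pos _
  have hδ : 0 < T.length s / (4 * E) := by positivity
  obtain ⟨p, hp0, hps, hp⟩ : ∃ p : unitInterval, 0 < p ∧ p < T.lower s ∧
      (T.lower s : ℝ) - p ≤ T.length s / (4 * E) := by
    have h0 : (0 : ℝ) < T.lower s := (T.isLeast_lower s).1.1.1
    obtain ⟨t, ht, hts⟩ := exists_between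
      (max_lt h0 (sub_lt_self (T.lower s : ℝ) hδ))
    refine ⟨⟨t, ((le_max_left _ _).trans_lt ht).le, hts.le.trans (T.lower s).2.2⟩, ?_, hts, ?_⟩
    · exact (le_max_left (0 : ℝ) _).trans_lt ht
    · have := (le_max_right _ _).trans_lt ht
      simp only
      linarith
  obtain ⟨q, hq1, hsq, hq⟩ : ∃ q : unitInterval, q < 1 ∧ T.upper s < q ∧
      (q : ℝ) - T.upper s ≤ T.length s / (4 * E) := by
    have h0 : (T.upper s : ℝ) < 1 := (T.isGreatest_upper s).1.1.2
    obtain ⟨t, hts, ht⟩ := exists_between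
      (lt_min h0 (lt_add_of_pos_right (T.upper s : ℝ) hδ))
    refine ⟨⟨t, (T.upper s).2.1.trans hts.le, (ht.trans_le (min_le_left _ _)).le⟩, ?_, hts, ?_⟩
    · exact ht.trans_le (min_le_left (1 : ℝ) _)
    · have := ht.trans_le (min_le_right _ _)
      simp only
      linarith
  have hpq : p < q := hps.trans ((T.lower_le_upper s).trans_lt hsq)
  have hpI : p ∈ Set.Ioo 0 1 := ⟨hp0, hpq.trans hq1⟩
  have hqI : q ∈ Set.Ioo 0 1 := ⟨hp0.trans hpq, hq1⟩
  have hφp : T.φ p < s := by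
    rw [← (T.isLeast_lower s).1.2]
    refine lt_of_le_of_ne (T.monotoneOn hpI (T.isLeast_lower s).1.1 hps.le) fun h => ?_
    exact hps.not_ge ((T.isLeast_lower s).2 ⟨hpI, h.trans (T.isLeast_lower s).1.2⟩)
  have hφq : s < T.φ q := by
    rw [← (T.isGreatest_upper s).1.2]
    refine lt_of_le_of_ne (T.monotoneOn (T.isGreatest_upper s).1.1 hqI hsq.le) fun h => ?_
    exact hsq.not_ge ((T.isGreatest_upper s).2 ⟨hqI, h.symm.trans (T.isGreatest_upper s).1.2⟩)
  -- Small enough that both `s - τ u` and `s + τ u` lie between `φ p` and `φ q`.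
  obtain ⟨u, hu0, hu⟩ := T.exists_τ_mem_Ioo hd
    (lt_min (sub_pos.2 hφp) (sub_pos.2 hφq))
  have hup := hu.trans_le (min_le_left _ _)
  have huq := hu.trans_le (min_le_right _ _)
  -- Beyond the budget `P` is vacuous. Within it, distortion at most `E` keeps the image of `[p, q]`
  -- comparable to that of the fibre, which in turn controls the distortion of the next generator.
  let P : (Fin d → ℕ) → ℝ → Prop := fun v t => t ≤ 4 * S →
    ∃ g : G, Multiplicative.toAdd (T.ρ g) = ι v ∧
      DistortionLE (g : unitInterval ≃ₜ unitInterval) p q (Real.exp (B * t))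
  have hP0 : P 0 0 := fun _ => ⟨1, by ext i; simp [ι], by
    simpa using DistortionLE.one p q⟩
  have hPE : ∀ t ≤ 4 * S, Real.exp (B * t) ≤ E := fun t ht =>
    Real.exp_le_exp.2 (mul_le_mul_of_nonneg_left ht hB)
  have hP : ∀ v t i, 0 ≤ t → P v t →
      P (v + Pi.single i 1) (t + T.length (s + T.τ (ι v)) ^ α) := by
    intro v t i _ hv ht
    have hc : 0 ≤ T.length (s + T.τ (ι v)) ^ α := Real.rpow_nonneg (T.length_nonneg _) _
    have ht' : t ≤ 4 * S := by linarith
    obtain ⟨g, hg, hgd⟩ := hv ht'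
    refine ⟨f i * g, ?_, ?_⟩
    · rw [map_mul, toAdd_mul, hg, hρf]
      ext j
      rcases eq_or_ne j i with rfl | hj
      · simp [ι, add_comm]
      · simp [ι, hj]
    · have h1 := T.apply_sub_apply_le hs hE hp hq hps hsq
        (hgd.mono (T.strictMono g) (hPE t ht'))
      rw [hg] at h1
      have hle := (T.strictMono g).monotone hpq.le
      have h2 := hf i _ _ hle
      have h3 : C * (((g : unitInterval ≃ₜ unitInterval) q : ℝ) -
          (g : unitInterval ≃ₜ unitInterval) p) ^ α ≤ B * T.length (s + T.τ (ι v)) ^ α := by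
        rw [hBdef, mul_assoc, ← Real.mul_rpow (by norm_num) (T.length_nonneg _)]
        exact mul_le_mul_of_nonneg_left (Real.rpow_le_rpow (sub_nonneg.2 hle) h1 hα0.le) hC
      have h4 := hgd.mul (T.strictMono (f i)) (T.strictMono g) (Real.exp_pos _).le
        (h2.mono (T.strictMono (f i)) (Real.exp_le_exp.2 h3))
      rw [← Real.exp_add, ← mul_add, add_comm _ t] at h4
      exact h4
  -- Paths stay in `ℕ^d`, so `u` is realised as the difference of its positive and negative parts.
  obtain ⟨w, ⟨t, ht, hwt⟩, t', ht', hwt'⟩ := exists_pair_cost_le (by omega)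
    (fun v => Real.rpow_nonneg (T.length_nonneg (s + T.τ (ι v))) α) hS hcS hP0 hP
    (fun i => (u i).toNat) fun i => (-u i).toNat
  obtain ⟨g, hg, hgd⟩ := hwt ht
  obtain ⟨g', hg', hgd'⟩ := hwt' ht'
  have hgg' : Multiplicative.toAdd (T.ρ g) = Multiplicative.toAdd (T.ρ g') + u := by
    rw [hg, hg']
    ext i
    simp only [ι, Pi.add_apply]
    omega
  -- `g` sends the fibres over `s - τ u` and `s` to those over `s + b` and `s + b + τ u`, and `g'`
  -- sends those over `s + τ u` and `s` to the same two in the opposite order.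
  have h1 := T.length_add_le hs hE hp0 hp hq1 hq hps hsq (hgd.mono (T.strictMono g) (hPE t ht))
    (r := s - T.τ u) (by linarith) ⟨by linarith, by linarith⟩
  have h2 := T.length_add_le hs hE hp0 hp hq1 hq hps hsq
    (hgd'.mono (T.strictMono g') (hPE t' ht')) (r := s + T.τ u) (by linarith)
    ⟨by linarith, by linarith⟩
  rw [hgg', map_add] at h1
  set b := T.τ (Multiplicative.toAdd (T.ρ g'))
  have e1 : s - T.τ u + (b + T.τ u) = s + b := by ring
  have e2 : s + T.τ u + b = s + (b + T.τ u) := by ring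
  rw [e1] at h1
  rw [e2] at h2
  have h3 : 0 < T.length (s + b) := by
    have hlt : (T.lower s : ℝ) < T.upper s := sub_pos.1 hs
    have := T.strictMono g' (show T.lower s < T.upper s from hlt)
    rw [T.apply_lower, T.apply_upper] at this
    exact sub_pos.2 (show (T.lower (s + b) : ℝ) < T.upper (s + b) from this)
  linarith

/-! ### Minimality and commutativity -/

lemma injOn_φ (h : ∀ r, T.length r = 0) : Set.InjOn T.φ (Set.Ioo 0 1) := by
  intro x hx y hy hxy
  have heq : T.upper (T.φ y) = T.lower (T.φ y) := Subtype.ext (sub_eq_zero.1 (h _))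
  have key : ∀ z ∈ T.fiber (T.φ y), z = T.lower (T.φ y) := fun z hz =>
    le_antisymm (heq ▸ (T.isGreatest_upper _).2 hz) ((T.isLeast_lower _).2 hz)
  rw [key x ⟨hx, hxy⟩, ← key y ⟨hy, rfl⟩]

/-- Injectivity gives each open interval a nondegenerate image under `φ`, which some translate of `φ
x` by the dense range of `τ` must hit. -/
lemma actsMinimally (hd : 2 ≤ d) (h : Set.InjOn T.φ (Set.Ioo 0 1)) : ActsMinimally G := by
  intro x hx y hy
  rw [mem_closure_iff_nhds]
  intro U hU
  obtain ⟨p, q, ⟨hpy, hyq⟩, hpqU⟩ := (mem_nhds_iff_exists_Ioo_subset' ⟨0, hy.1⟩ ⟨1, hy.2⟩).1 hU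
  have hpq : max p 0 < min q 1 := max_lt (lt_min (hpy.trans hyq) (hpy.trans hy.2))
    (lt_min (hy.1.trans hyq) zero_lt_one)
  obtain ⟨p', hp', hp'q⟩ := exists_between hpq
  obtain ⟨q', hpq', hq'⟩ := exists_between hp'q
  have hpI : p' ∈ Set.Ioo 0 1 :=
    ⟨(le_max_right _ _).trans_lt hp', hp'q.trans_le (min_le_right _ _)⟩
  have hqI : q' ∈ Set.Ioo 0 1 := ⟨hpI.1.trans hpq', hq'.trans_le (min_le_right _ _)⟩
  have hφ : T.φ p' < T.φ q' := lt_of_le_of_ne (T.monotoneOn hpI hqI hpq'.le)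
    fun heq => hpq'.ne (h hpI hqI heq)
  obtain ⟨v, hv1, hv2⟩ := T.exists_τ_mem_Ioo hd (sub_lt_sub_right hφ (T.φ x))
  obtain ⟨g, hg⟩ := T.exists_ρ_eq v
  have hgx := T.map_apply g x hx
  rw [hg] at hgx
  have hgI : (g : unitInterval ≃ₜ unitInterval) x ∈ Set.Ioo 0 1 :=
    (T.strictMono g).homeomorph_mem_Ioo.2 hx
  refine ⟨(g : unitInterval ≃ₜ unitInterval) x, hpqU ⟨?_, ?_⟩, g, g.2, rfl⟩
  · exact ((le_max_left _ _).trans_lt hp').trans (T.lt_of_φ_lt hpI hgI (by linarith))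
  · exact (T.lt_of_φ_lt hgI hqI (by linarith)).trans (hq'.trans_le (min_le_left _ _))

lemma mul_comm_of_injOn (h : Set.InjOn T.φ (Set.Ioo 0 1)) (f g : G) :
    (f : unitInterval ≃ₜ unitInterval) * g = g * f := by
  ext1 x
  simp only [Homeomorph.mul_apply]
  have hf := T.strictMono f
  have hg := T.strictMono g
  by_cases hx : x ∈ Set.Ioo 0 1
  · have hfx := hf.homeomorph_mem_Ioo.2 hx
    have hgx := hg.homeomorph_mem_Ioo.2 hx
    refine h (hf.homeomorph_mem_Ioo.2 hgx) (hg.homeomorph_mem_Ioo.2 hfx) ?_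
    rw [T.map_apply f _ hgx, T.map_apply g _ hx, T.map_apply g _ hfx, T.map_apply f _ hx]
    ring
  · have : x = 0 ∨ x = 1 := by
      by_contra hcon
      rw [not_or] at hcon
      exact hx ⟨unitInterval.pos_iff_ne_zero.2 hcon.1, unitInterval.lt_one_iff_ne_one.2 hcon.2⟩
    rcases this with rfl | rfl
    · simp only [hf.homeomorph_zero, hg.homeomorph_zero]
    · simp only [hf.homeomorph_one, hg.homeomorph_one]

end TranslationSemiconj

theorem mainTheorem3 (d : ℕ) (hd : 2 ≤ d) (α : ℝ) (hα : 1 / (d : ℝ) < α)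
    (G : Subgroup (unitInterval ≃ₜ unitInterval))
    (hG : ∀ g ∈ G, IsDiffHolder α g)
    (hsemi : IsSemiconjToFreeTranslations d G) :
    ActsMinimally G ∧ ∀ g ∈ G, ∀ h ∈ G, g * h = h * g := by
  obtain ⟨ρ, τ, φ, hρ, hτ, hc, hm, hs, heq⟩ := hsemi
  let T : TranslationSemiconj d G := ⟨ρ, τ, φ, fun g => (hG g g.2).1, hρ, hτ, hc, hm, hs, heq⟩
  have hd1 : 1 / (d : ℝ) < 1 := by
    rw [div_lt_one (by positivity)]
    exact_mod_cast (by omega : 1 < d)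
  -- Young's inequality needs an exponent below `1`; lowering the Hölder exponent to `β` is
  -- harmless.
  obtain ⟨β, hβ, hβα⟩ := exists_between (lt_min hα hd1)
  have hβ0 : 0 < β := lt_trans (by positivity) hβ
  have hinj : Set.InjOn T.φ (Set.Ioo 0 1) := T.injOn_φ <|
    T.length_eq_zero hd hβ (hβα.trans_le (min_le_right _ _)) fun g hg =>
      (hG g hg).mono_exponent hβ0 (hβα.trans_le (min_le_left _ _)).le
  exact ⟨T.actsMinimally hd hinj, fun g hg h hh => T.mul_comm_of_injOn hinj ⟨g, hg⟩ ⟨h, hh⟩⟩
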